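/- **Setting.** A transmitter has $N_t>1$ antennas. Fix $\theta>0$ (path gain), $\sigma>0$ (noise standard deviation) and a transmit power $P>0$. The channel is i.i.d. Rayleigh fading: $\mathbf h\sim\mathcal{CN}(\mathbf 0,\mathbf I_{N_t})$, with normalized power $H=\frac1{N_t}\|\mathbf h\|^2$. *Periodic switching* with time fraction $\tau$ has, in a block with channel $\mathbf h$, information rate $R^{(P)}=\tau\log_2(1+\theta PH/\sigma^2)$ and harvested power $Q^{(P)}=(1-\tau)\theta PH$. *Threshold switching* with $N$ random beams ($1\le N\le N_t$) and threshold $\bar A$ uses $N$ independent Gaussian beams $\boldsymbol\phi_1,\dots,\boldsymbol\phi_N\sim\mathcal{CN}(\mathbf 0,\frac1{N_t}\mathbf I_{N_t})$, independent of $\mathbf h$. With $A=\frac1N\sum_{n=1}^N|\boldsymbol\phi_n^T\mathbf h|^2$, and $\rho=1$ if $A\le\bar A$, $\rho=0$ otherwise, its rate and harvested power in a block with channel $\mathbf h$ are the conditional expectations given $\mathbf h$, $R^{(T)}=\mathbb E[\rho\log_2(1+\theta PA/\sigma^2)\mid\mathbf h]$ and $Q^{(T)}=\mathbb E[(1-\rho)\theta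 PA\mid\mathbf h]$. For each scheme, define the rate pre-log factor $\Delta=\lim_{p\to\infty}\mathbb E_{\mathbf h}[R]\big|_{P=p}/\log_2 p$ and the power scaling factor $\Pi=\mathbb E_{\mathbf h}[Q]/(\theta P)$. Write $\Delta^{(P)}(\tau),\Pi^{(P)}(\tau)$ for periodic switching and $\Delta^{(T)}(N,\bar A),\Pi^{(T)}(N,\bar A)$ for threshold switching. **Theorem.** The limits defining $\Delta^{(T)}(N,\bar A)$ and $\Delta^{(P)}(\tau)$ exist for all $1\le N\le N_t$, $0<\bar A<\infty$, $0<\tau<1$, and: 1. If $1\le N\le N_t$, $0<\bar A<\infty$, $0<\tau<1$ and $0<\Pi^{(T)}(N,\bar A)=\Pi^{(P)}(\tau)<1$, then $\Delta^{(T)}(N,\bar A)>\Delta^{(P)}(\tau)$. 2. If $1\le N<M\le N_t$, $0<\bar A_N,\bar A_M<\infty$ and $0<\Pi^{(T)}(N,\bar A_N)=\Pi^{(T)}(M,\bar A_M)<1$, then $\Delta^{(T)}(N,\bar A_N)>\Delta^{(T)}(M,\bar A_M)$. 3. Consequently a single random beam is asymptotically optimal: for every $q\in(0,1)$ there is $\bar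 A_1>0$ with $\Pi^{(T)}(1,\bar A_1)=q$ such that $\Delta^{(T)}(1,\bar A_1)>\Delta^{(T)}(M,\bar A_M)$ whenever $1<M\le N_t$, $\bar A_M>0$ and $\Pi^{(T)}(M,\bar A_M)=q$, and $\Delta^{(T)}(1,\bar A_1)>\Delta^{(P)}(\tau)$ whenever $0<\tau<1$ and $\Pi^{(P)}(\tau)=q$. -/

import Mathlib

open MeasureTheory ProbabilityTheory Filter Topology
open scoped NNReal

namespace SWIPT

noncomputable section

/-- The circularly symmetric complex Gaussian law `CN(0, v)`: real and imaginary parts are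
independent, centred, and each of variance `v / 2`. -/
def complexGaussian (v : ℝ≥0) : Measure ℂ :=
  ((gaussianReal 0 (v / 2)).prod (gaussianReal 0 (v / 2))).map (fun p : ℝ × ℝ => (⟨p.1, p.2⟩ : ℂ))

/-- I.i.d. Rayleigh fading with `Nt` transmit antennas: the law `CN(0, I)` of the channel
vector `h`. -/
def channelLaw (Nt : ℕ) : Measure (Fin Nt → ℂ) :=
  Measure.pi fun _ => complexGaussian 1

/-- The law of `N` independent Gaussian random beams `φ₁, …, φ_N`, each distributed as
`CN(0, (1 / Nt) I)`; the `n`-th beam of `Φ` is the vector `Φ n`. -/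
def beamLaw (Nt N : ℕ) : Measure (Fin N → Fin Nt → ℂ) :=
  Measure.pi fun _ => Measure.pi fun _ => complexGaussian ((Nt : ℝ≥0)⁻¹)

/-- The normalized average channel power `H = ‖h‖² / Nt`. -/
def channelPower {Nt : ℕ} (h : Fin Nt → ℂ) : ℝ :=
  (1 / (Nt : ℝ)) * ∑ i, ‖h i‖ ^ 2

/-- The equivalent channel `a = Φᵀ h` of a sub-block (no complex conjugation). -/
def equivalentChannel {Nt N : ℕ} (h : Fin Nt → ℂ) (Φ : Fin N → Fin Nt → ℂ) (n : Fin N) : ℂ :=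
  ∑ i, Φ n i * h i

/-- The normalized channel power `A = ‖Φᵀ h‖² / N` of a sub-block. -/
def subblockPower {Nt N : ℕ} (h : Fin Nt → ℂ) (Φ : Fin N → Fin Nt → ℂ) : ℝ :=
  (1 / (N : ℝ)) * ∑ n, ‖equivalentChannel h Φ n‖ ^ 2

/-- The threshold switching rule `ρ`: information decoding (`1`) if the channel power `a` is at
most the threshold `Abar`, and energy harvesting (`0`) otherwise. -/
def switching (Abar a : ℝ) : ℝ :=
  if a ≤ Abar then 1 else 0

/-- Information rate of threshold switching in a block with channel `h`: the expectation of
`ρ log₂(1 + θ P A / σ²)` over the random beams. -/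
def rateTS (θ σ P : ℝ) {Nt : ℕ} (h : Fin Nt → ℂ) (N : ℕ) (Abar : ℝ) : ℝ :=
  ∫ Φ, switching Abar (subblockPower h Φ) *
    Real.logb 2 (1 + θ * P * subblockPower h Φ / σ ^ 2) ∂(beamLaw Nt N)

/-- Harvested power of threshold switching in a block with channel `h`: the expectation of
`(1 - ρ) θ P A` over the random beams. -/
def powerTS (θ P : ℝ) {Nt : ℕ} (h : Fin Nt → ℂ) (N : ℕ) (Abar : ℝ) : ℝ :=
  ∫ Φ, (1 - switching Abar (subblockPower h Φ)) * (θ * P * subblockPower h Φ) ∂(beamLaw Nt N)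

/-- Information rate of periodic switching in a block with channel `h`, where a fraction `τ` of
the block is used for information decoding. -/
def ratePS (θ σ P : ℝ) {Nt : ℕ} (h : Fin Nt → ℂ) (τ : ℝ) : ℝ :=
  τ * Real.logb 2 (1 + θ * P * channelPower h / σ ^ 2)

/-- Harvested power of periodic switching in a block with channel `h`. -/
def powerPS (θ P : ℝ) {Nt : ℕ} (h : Fin Nt → ℂ) (τ : ℝ) : ℝ :=
  (1 - τ) * (θ * P * channelPower h)

/-- Average rate of threshold switching over the fading channel. -/
def avgRateTS (θ σ P : ℝ) (Nt N : ℕ) (Abar : ℝ) : ℝ :=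
  ∫ h, rateTS θ σ P h N Abar ∂(channelLaw Nt)

/-- Average harvested power of threshold switching over the fading channel. -/
def avgPowerTS (θ P : ℝ) (Nt N : ℕ) (Abar : ℝ) : ℝ :=
  ∫ h, powerTS θ P h N Abar ∂(channelLaw Nt)

/-- Average rate of periodic switching over the fading channel. -/
def avgRatePS (θ σ P : ℝ) (Nt : ℕ) (τ : ℝ) : ℝ :=
  ∫ h, ratePS θ σ P h τ ∂(channelLaw Nt)

/-- Average harvested power of periodic switching over the fading channel. -/
def avgPowerPS (θ P : ℝ) (Nt : ℕ) (τ : ℝ) : ℝ :=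
  ∫ h, powerPS θ P h τ ∂(channelLaw Nt)

/-- The rate pre-log factor `lim_{P → ∞} R̄(P) / log₂ P` of threshold switching. -/
def rateFactorTS (θ σ : ℝ) (Nt N : ℕ) (Abar : ℝ) : ℝ :=
  limUnder atTop fun P : ℝ => avgRateTS θ σ P Nt N Abar / Real.logb 2 P

/-- The rate pre-log factor `lim_{P → ∞} R̄(P) / log₂ P` of periodic switching. -/
def rateFactorPS (θ σ : ℝ) (Nt : ℕ) (τ : ℝ) : ℝ :=
  limUnder atTop fun P : ℝ => avgRatePS θ σ P Nt τ / Real.logb 2 P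

/-- The power scaling factor of threshold switching: average harvested power over `θ P`. -/
def powerFactorTS (θ P : ℝ) (Nt N : ℕ) (Abar : ℝ) : ℝ :=
  avgPowerTS θ P Nt N Abar / (θ * P)

/-- The power scaling factor of periodic switching: average harvested power over `θ P`. -/
def powerFactorPS (θ P : ℝ) (Nt : ℕ) (τ : ℝ) : ℝ :=
  avgPowerPS θ P Nt τ / (θ * P)

end

end SWIPT

namespace SWIPT

/-! Let `X_N` be the sub-block power under the joint law of channel and beams; its mean is one.
Dominated convergence turns the pre-log factor into `P(X_N ≤ a)`, and the power factor is `E[X_N;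
X_N > a]`. For periodic switching the two factors are `τ` and `1 - τ`. Hence, at a fixed power
factor, the partial mean `E[X_N; X_N ≤ a]` is also fixed, and probabilities remain to be compared.

Against periodic switching, that partial mean equals `τ`, and it is below `P(X_N ≤ a)` because
conditioning on small values lowers the mean (`setIntegral_le_lt_measure`).

For `N < M`, the power `X_M` is an average of copies of `X_N`, one per cyclic block of `N` beams, so
strict Jensen gives `E(a - X_M)⁺ < E(a - X_N)⁺` (`integral_posPart_jointPower_lt`). The right side
is `a P(X_N ≤ a) - E[X_N; X_N ≤ a]`; the left side is at least `a P(X_M ≤ b) - E[X_M; X_M ≤ b]` for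
every `b`. Equal partial means cancel and leave the comparison of probabilities.

The threshold for one beam comes from the intermediate value theorem, since `X_1` has no atoms. -/

instance (v : ℝ≥0) : IsProbabilityMeasure (complexGaussian v) :=
  Measure.isProbabilityMeasure_map Complex.measurableEquivRealProd.symm.measurable.aemeasurable

instance (Nt : ℕ) : IsProbabilityMeasure (channelLaw Nt) := by
  unfold channelLaw; infer_instance

instance (Nt N : ℕ) : IsProbabilityMeasure (beamLaw Nt N) := by
  unfold beamLaw; infer_instance

/-! ### Linear forms in complex Gaussian variables. -/

lemma complexGaussian_eq_map (v : ℝ≥0) : complexGaussian v =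
    ((gaussianReal 0 (v / 2)).prod (gaussianReal 0 (v / 2))).map
      Complex.measurableEquivRealProd.symm := rfl

lemma complexGaussian_absolutelyContinuous {v : ℝ≥0} (hv : v ≠ 0) :
    complexGaussian v ≪ volume := by
  have h2 : v / 2 ≠ 0 := by simpa using hv
  rw [complexGaussian_eq_map,
    ← (Complex.volume_preserving_equiv_real_prod.symm Complex.measurableEquivRealProd).map_eq]
  exact ((gaussianReal_absolutelyContinuous 0 h2).prod
    (gaussianReal_absolutelyContinuous 0 h2)).map Complex.measurableEquivRealProd.symm.measurable

lemma absolutelyContinuous_complexGaussian {v : ℝ≥0} (hv : v ≠ 0) :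
    volume ≪ complexGaussian v := by
  have h2 : v / 2 ≠ 0 := by simpa using hv
  rw [complexGaussian_eq_map,
    ← (Complex.volume_preserving_equiv_real_prod.symm Complex.measurableEquivRealProd).map_eq]
  exact ((gaussianReal_absolutelyContinuous' 0 h2).prod
    (gaussianReal_absolutelyContinuous' 0 h2)).map Complex.measurableEquivRealProd.symm.measurable

lemma isOpenPosMeasure_complexGaussian {v : ℝ≥0} (hv : v ≠ 0) :
    (complexGaussian v).IsOpenPosMeasure :=
  (absolutelyContinuous_complexGaussian hv).isOpenPosMeasure

lemma memLp_id_complexGaussian (v : ℝ≥0) : MemLp (fun z : ℂ => z) 2 (complexGaussian v) := by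
  rw [complexGaussian_eq_map, memLp_map_measure_iff (by fun_prop)
    Complex.measurableEquivRealProd.symm.measurable.aemeasurable, memLp_re_im_iff.symm]
  have h := memLp_id_gaussianReal' (μ := 0) (v := v / 2) 2 (by simp)
  exact ⟨h.comp_fst (gaussianReal 0 (v / 2)), h.comp_snd (gaussianReal 0 (v / 2))⟩

/-- A real linear combination of the real and imaginary parts of a complex Gaussian. -/
lemma integral_variance_re_im_complexGaussian (v : ℝ≥0) (a b : ℝ) :
    ∫ z, (a * z.re + b * z.im) ∂(complexGaussian v) = 0 ∧
      Var[fun z => a * z.re + b * z.im; complexGaussian v] = (a ^ 2 + b ^ 2) * (v / 2) := by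
  have hL := memLp_id_gaussianReal' (μ := 0) (v := v / 2) 2 (by simp)
  have ha : MemLp (fun x : ℝ => a * x) 2 (gaussianReal 0 (v / 2)) := hL.const_mul a
  have hb : MemLp (fun x : ℝ => b * x) 2 (gaussianReal 0 (v / 2)) := hL.const_mul b
  rw [complexGaussian_eq_map]
  constructor
  · rw [integral_map_equiv]
    change ∫ x : ℝ × ℝ, a * x.1 + b * x.2 ∂_ = 0
    rw [integral_add ((ha.integrable (by norm_num)).comp_fst _)
      ((hb.integrable (by norm_num)).comp_snd _), integral_fun_fst (fun x => a * x),
      integral_fun_snd (fun x => b * x), integral_const_mul, integral_const_mul]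
    simp
  · rw [variance_map (by fun_prop) (by fun_prop)]
    change Var[fun x : ℝ × ℝ => a * x.1 + b * x.2; _] = _
    rw [variance_add_prod ha hb, variance_const_mul, variance_const_mul]
    simp
    ring

/-- The real and imaginary parts of the form are sums of independent centred real variables, so
their second moments are variances and add up. -/
lemma integral_normSq_sum_complexGaussian (n : ℕ) (v : ℝ≥0) (c : Fin n → ℂ) :
    Integrable (fun x : Fin n → ℂ => ‖∑ i, x i * c i‖ ^ 2)
      (Measure.pi fun _ => complexGaussian v) ∧
    ∫ x : Fin n → ℂ, ‖∑ i, x i * c i‖ ^ 2 ∂(Measure.pi fun _ => complexGaussian v) =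
      v * ∑ i, ‖c i‖ ^ 2 := by
  have hz := memLp_id_complexGaussian v
  have key (a b : Fin n → ℝ) :
      Integrable (fun x : Fin n → ℂ => (∑ i, (a i * (x i).re + b i * (x i).im)) ^ 2)
        (Measure.pi fun _ => complexGaussian v) ∧
      ∫ x : Fin n → ℂ, (∑ i, (a i * (x i).re + b i * (x i).im)) ^ 2
        ∂(Measure.pi fun _ => complexGaussian v) = (v / 2) * ∑ i, (a i ^ 2 + b i ^ 2) := by
    have hf (i : Fin n) : MemLp (fun z : ℂ => a i * z.re + b i * z.im) 2 (complexGaussian v) :=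
      (hz.re.const_mul (a i)).add (hz.im.const_mul (b i))
    have hf' (i : Fin n) : MemLp (fun x : Fin n → ℂ => a i * (x i).re + b i * (x i).im) 2
        (Measure.pi fun _ => complexGaussian v) :=
      (hf i).comp_measurePreserving (measurePreserving_eval (fun _ => complexGaussian v) i)
    have hsum : MemLp (fun x : Fin n → ℂ => ∑ i, (a i * (x i).re + b i * (x i).im)) 2
        (Measure.pi fun _ => complexGaussian v) := memLp_finsetSum _ fun i _ => hf' i
    refine ⟨hsum.integrable_sq, ?_⟩
    have hmean : ∫ x : Fin n → ℂ, (∑ i, (a i * (x i).re + b i * (x i).im))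
        ∂(Measure.pi fun _ => complexGaussian v) = 0 := by
      rw [integral_finsetSum _ fun i _ => (hf' i).integrable (by norm_num)]
      refine Finset.sum_eq_zero fun i _ => ?_
      rw [integral_comp_eval (μ := fun _ : Fin n => complexGaussian v)
        (f := fun z : ℂ => a i * z.re + b i * z.im) (hf i).aestronglyMeasurable]
      exact (integral_variance_re_im_complexGaussian v _ _).1
    have hvar := variance_sum_pi (μ := fun _ : Fin n => complexGaussian v) hf
    rw [← variance_of_integral_eq_zero hsum.aemeasurable hmean, Finset.mul_sum]
    convert! hvar using 2
    · ext x
      simp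
    · rw [(integral_variance_re_im_complexGaussian v _ _).2, mul_comm]
  have hre := key (fun i => (c i).re) (fun i => -(c i).im)
  have him := key (fun i => (c i).im) (fun i => (c i).re)
  have heq (x : Fin n → ℂ) : ‖∑ i, x i * c i‖ ^ 2 =
      (∑ i, ((c i).re * (x i).re + -(c i).im * (x i).im)) ^ 2 +
        (∑ i, ((c i).im * (x i).re + (c i).re * (x i).im)) ^ 2 := by
    rw [← Complex.normSq_eq_norm_sq, Complex.normSq_apply, Complex.re_sum, Complex.im_sum,
      ← sq, ← sq]
    congr 3 <;> ext i <;> simp <;> ring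
  simp only [heq]
  refine ⟨hre.1.add him.1, ?_⟩
  rw [integral_add hre.1 him.1, hre.2, him.2, ← mul_add, ← Finset.sum_add_distrib, div_mul_eq_mul_div,
    mul_div_assoc, Finset.sum_div]
  congr 2
  ext i
  rw [← Complex.normSq_eq_norm_sq, Complex.normSq_apply]
  ring

/-- A nontrivial linear form in i.i.d. complex Gaussians has a modulus without atoms. -/
lemma pi_complexGaussian_normSq_eq_null {n : ℕ} {v : ℝ≥0} (hv : v ≠ 0) {c : Fin n → ℂ}
    (hc : c ≠ 0) (a : ℝ) :
    (Measure.pi fun _ : Fin n => complexGaussian v) {x | ‖∑ i, x i * c i‖ ^ 2 = a} = 0 := by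
  obtain ⟨i, hi⟩ := Function.ne_iff.1 hc
  obtain ⟨k, rfl⟩ : ∃ k, n = k + 1 := ⟨n - 1, by have := i.pos; omega⟩
  have hmp := measurePreserving_piFinSuccAbove (fun _ : Fin (k + 1) => complexGaussian v) i
  have hs : MeasurableSet {p : ℂ × (Fin k → ℂ) |
      ‖p.1 * c i + ∑ j, p.2 j * c (i.succAbove j)‖ ^ 2 = a} :=
    measurableSet_eq_fun (by fun_prop) measurable_const
  have hpre : {x : Fin (k + 1) → ℂ | ‖∑ i, x i * c i‖ ^ 2 = a} =
      MeasurableEquiv.piFinSuccAbove (fun _ => ℂ) i ⁻¹' {p : ℂ × (Fin k → ℂ) |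
        ‖p.1 * c i + ∑ j, p.2 j * c (i.succAbove j)‖ ^ 2 = a} := by
    ext x
    simp only [Set.mem_preimage, Fin.sum_univ_succAbove _ i]
    rfl
  rw [hpre, hmp.measure_preimage hs.nullMeasurableSet, Measure.prod_apply_symm hs,
    lintegral_eq_zero_iff (measurable_measure_prodMk_right hs)]
  refine ae_of_all _ fun w => complexGaussian_absolutelyContinuous hv ?_
  -- With the other coordinates frozen at `w`, the condition on the remaining one confines it to a
  -- circle, which is Lebesgue null.
  refine measure_mono_null (t := Metric.sphere (-(∑ j, w j * c (i.succAbove j)) / c i)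
    (√a / ‖c i‖)) ?_ (Measure.addHaar_sphere _ _ _)
  intro z hz
  have hci : ‖c i‖ ≠ 0 := by simpa using hi
  have hz' : ‖z * c i + ∑ j, w j * c (i.succAbove j)‖ ^ 2 = a := hz
  rw [mem_sphere_iff_norm, eq_div_iff hci, ← norm_mul, ← hz', Real.sqrt_sq (norm_nonneg _)]
  congr 1
  have : c i ≠ 0 := hi
  field_simp
  ring

/-! ### The sub-block power under the joint law. -/

/-- The joint law of the channel and the random beams. -/
noncomputable def jointLaw (Nt N : ℕ) : Measure ((Fin Nt → ℂ) × (Fin N → Fin Nt → ℂ)) :=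
  (channelLaw Nt).prod (beamLaw Nt N)

/-- The sub-block power as a random variable under `jointLaw`. -/
noncomputable def jointPower (Nt N : ℕ) (p : (Fin Nt → ℂ) × (Fin N → Fin Nt → ℂ)) : ℝ :=
  subblockPower p.1 p.2

instance (Nt N : ℕ) : IsProbabilityMeasure (jointLaw Nt N) := by
  unfold jointLaw; infer_instance

/-- Makes strictness in Jensen's inequality a matter of exhibiting a single configuration in an open
set. -/
lemma isOpenPosMeasure_jointLaw {Nt : ℕ} (hNt : Nt ≠ 0) (N : ℕ) :
    (jointLaw Nt N).IsOpenPosMeasure := by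
  have := isOpenPosMeasure_complexGaussian one_ne_zero
  have : (complexGaussian ((Nt : ℝ≥0)⁻¹)).IsOpenPosMeasure :=
    isOpenPosMeasure_complexGaussian (by simpa using hNt)
  have hchannel : (channelLaw Nt).IsOpenPosMeasure := by
    unfold channelLaw; infer_instance
  have hbeam : (beamLaw Nt N).IsOpenPosMeasure := by
    unfold beamLaw; infer_instance
  unfold jointLaw
  infer_instance

lemma continuous_equivalentChannel (Nt N : ℕ) (n : Fin N) :
    Continuous fun p : (Fin Nt → ℂ) × (Fin N → Fin Nt → ℂ) => equivalentChannel p.1 p.2 n := by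
  unfold equivalentChannel; fun_prop

lemma continuous_jointPower (Nt N : ℕ) : Continuous (jointPower Nt N) := by
  have := continuous_equivalentChannel Nt N
  unfold jointPower subblockPower; fun_prop

lemma jointPower_nonneg {Nt N : ℕ} (p : (Fin Nt → ℂ) × (Fin N → Fin Nt → ℂ)) :
    0 ≤ jointPower Nt N p := by
  unfold jointPower subblockPower; positivity

lemma continuous_channelPower (Nt : ℕ) :
    Continuous (channelPower : (Fin Nt → ℂ) → ℝ) := by
  unfold channelPower; fun_prop

lemma channelPower_nonneg {Nt : ℕ} (h : Fin Nt → ℂ) : 0 ≤ channelPower h := by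
  unfold channelPower; positivity

lemma integrable_channelPower (Nt : ℕ) :
    Integrable (fun h => channelPower h) (channelLaw Nt) ∧
      (Nt ≠ 0 → ∫ h, channelPower h ∂(channelLaw Nt) = 1) := by
  have hX (i : Fin Nt) : Integrable (fun h : Fin Nt → ℂ => ‖h i‖ ^ 2) (channelLaw Nt) ∧
      ∫ h, ‖h i‖ ^ 2 ∂(channelLaw Nt) = 1 := by
    -- A unit vector as coefficient vector extracts one coordinate.
    have := integral_normSq_sum_complexGaussian Nt 1 (Pi.single i 1)
    simpa [Pi.single_apply, channelLaw, apply_ite, ite_pow] using this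
  have hsum : Integrable (fun h : Fin Nt → ℂ => ∑ i, ‖h i‖ ^ 2) (channelLaw Nt) :=
    integrable_finsetSum _ fun i _ => (hX i).1
  refine ⟨hsum.const_mul _, fun hNt => ?_⟩
  unfold channelPower
  rw [integral_const_mul, integral_finsetSum _ fun i _ => (hX i).1]
  simp [hX, hNt]

lemma ae_channel_ne_zero {Nt : ℕ} (hNt : Nt ≠ 0) : ∀ᵐ h ∂(channelLaw Nt), h ≠ 0 := by
  have hpos : 0 < Nt := Nat.pos_of_ne_zero hNt
  have hc : (Pi.single ⟨0, hpos⟩ 1 : Fin Nt → ℂ) ≠ 0 := by simp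
  refine measure_mono_null ?_ (pi_complexGaussian_normSq_eq_null one_ne_zero hc 0)
  intro h hh
  have : h = 0 := by simpa using hh
  simp [this]

lemma ae_channelPower_pos {Nt : ℕ} (hNt : Nt ≠ 0) : ∀ᵐ h ∂(channelLaw Nt), 0 < channelPower h := by
  filter_upwards [ae_channel_ne_zero hNt] with h hh
  obtain ⟨i, hi⟩ := Function.ne_iff.1 hh
  have : 0 < ∑ i, ‖h i‖ ^ 2 :=
    Finset.sum_pos' (fun _ _ => by positivity) ⟨i, Finset.mem_univ _, by
      have : 0 < ‖h i‖ := norm_pos_iff.2 hi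
      positivity⟩
  have : (0 : ℝ) < Nt := by exact_mod_cast Nat.pos_of_ne_zero hNt
  unfold channelPower; positivity

lemma measurePreserving_beam (Nt N : ℕ) (n : Fin N) :
    MeasurePreserving (fun Φ : Fin N → Fin Nt → ℂ => Φ n) (beamLaw Nt N)
      (Measure.pi fun _ => complexGaussian ((Nt : ℝ≥0)⁻¹)) :=
  measurePreserving_eval (fun _ : Fin N =>
    Measure.pi fun _ : Fin Nt => complexGaussian ((Nt : ℝ≥0)⁻¹)) n

lemma integral_normSq_equivalentChannel {Nt N : ℕ} (h : Fin Nt → ℂ) (n : Fin N) :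
    Integrable (fun Φ => ‖equivalentChannel h Φ n‖ ^ 2) (beamLaw Nt N) ∧
      ∫ Φ, ‖equivalentChannel h Φ n‖ ^ 2 ∂(beamLaw Nt N) = channelPower h := by
  have hm := measurePreserving_beam Nt N n
  have hi := integral_normSq_sum_complexGaussian Nt ((Nt : ℝ≥0)⁻¹) h
  refine ⟨hm.integrable_comp_of_integrable hi.1, ?_⟩
  have := integral_map (μ := beamLaw Nt N) hm.measurable.aemeasurable
    (f := fun x : Fin Nt → ℂ => ‖∑ i, x i * h i‖ ^ 2) (by rw [hm.map_eq]; exact hi.1.1)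
  rw [hm.map_eq, hi.2] at this
  simpa [channelPower, equivalentChannel] using this.symm

lemma integral_joint_normSq_equivalentChannel {Nt N : ℕ} (hNt : Nt ≠ 0) (n : Fin N) :
    Integrable (fun p => ‖equivalentChannel p.1 p.2 n‖ ^ 2) (jointLaw Nt N) ∧
      ∫ p, ‖equivalentChannel p.1 p.2 n‖ ^ 2 ∂(jointLaw Nt N) = 1 := by
  have hint : Integrable (fun p => ‖equivalentChannel p.1 p.2 n‖ ^ 2) (jointLaw Nt N) := by
    have := continuous_equivalentChannel Nt N n
    refine (integrable_prod_iff (Continuous.aestronglyMeasurable (by fun_prop))).2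
      ⟨ae_of_all _ fun h => (integral_normSq_equivalentChannel h n).1, ?_⟩
    simpa [(integral_normSq_equivalentChannel _ n).2] using (integrable_channelPower Nt).1
  refine ⟨hint, ?_⟩
  rw [jointLaw, integral_prod _ hint]
  simp [(integral_normSq_equivalentChannel _ n).2, (integrable_channelPower Nt).2 hNt]

lemma integrable_jointPower {Nt : ℕ} (hNt : Nt ≠ 0) (N : ℕ) :
    Integrable (jointPower Nt N) (jointLaw Nt N) :=
  (integrable_finsetSum _ fun n _ =>
    (integral_joint_normSq_equivalentChannel hNt n).1).const_mul _

lemma integral_jointPower {Nt N : ℕ} (hNt : Nt ≠ 0) (hN : N ≠ 0) :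
    ∫ p, jointPower Nt N p ∂(jointLaw Nt N) = 1 := by
  unfold jointPower subblockPower
  rw [integral_const_mul, integral_finsetSum _ fun n _ =>
    (integral_joint_normSq_equivalentChannel hNt n).1]
  simp [(integral_joint_normSq_equivalentChannel hNt _).2, hN]

/-- Given a nonzero channel, the equivalent channel is a nontrivial linear form in one Gaussian
beam, so its modulus has no atoms. -/
lemma ae_normSq_equivalentChannel_ne {Nt N : ℕ} (hNt : Nt ≠ 0) (n : Fin N) (a : ℝ) :
    ∀ᵐ p ∂(jointLaw Nt N), ‖equivalentChannel p.1 p.2 n‖ ^ 2 ≠ a := by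
  have hc := continuous_equivalentChannel Nt N n
  have hs : MeasurableSet {p : (Fin Nt → ℂ) × (Fin N → Fin Nt → ℂ) |
      ‖equivalentChannel p.1 p.2 n‖ ^ 2 = a} :=
    measurableSet_eq_fun (by fun_prop) measurable_const
  refine measure_mono_null (t := {p : (Fin Nt → ℂ) × (Fin N → Fin Nt → ℂ) |
      ‖equivalentChannel p.1 p.2 n‖ ^ 2 = a}) (fun p hp => by simpa using hp) ?_
  rw [jointLaw, Measure.measure_prod_null hs]
  filter_upwards [ae_channel_ne_zero hNt] with h hh
  have hnull := pi_complexGaussian_normSq_eq_null (v := (Nt : ℝ≥0)⁻¹) (by simpa using hNt) hh a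
  exact (measurePreserving_beam Nt N n).quasiMeasurePreserving.preimage_null hnull

lemma jointPower_pos {Nt N : ℕ} {p : (Fin Nt → ℂ) × (Fin N → Fin Nt → ℂ)} (n : Fin N)
    (hn : ‖equivalentChannel p.1 p.2 n‖ ^ 2 ≠ 0) : 0 < jointPower Nt N p := by
  have hsum : 0 < ∑ m, ‖equivalentChannel p.1 p.2 m‖ ^ 2 :=
    Finset.sum_pos' (fun _ _ => sq_nonneg _)
      ⟨n, Finset.mem_univ _, lt_of_le_of_ne (sq_nonneg _) hn.symm⟩
  have hN : (0 : ℝ) < N := by exact_mod_cast n.pos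
  exact mul_pos (one_div_pos.2 hN) hsum

lemma ae_jointPower_pos {Nt N : ℕ} (hNt : Nt ≠ 0) (hN : N ≠ 0) :
    ∀ᵐ p ∂(jointLaw Nt N), 0 < jointPower Nt N p :=
  (ae_normSq_equivalentChannel_ne hNt ⟨0, Nat.pos_of_ne_zero hN⟩ 0).mono fun _ hp =>
    jointPower_pos _ hp

lemma ae_jointPower_one_ne {Nt : ℕ} (hNt : Nt ≠ 0) (a : ℝ) :
    ∀ᵐ p ∂(jointLaw Nt 1), jointPower Nt 1 p ≠ a := by
  filter_upwards [ae_normSq_equivalentChannel_ne hNt (0 : Fin 1) a] with p hp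
  simpa [jointPower, subblockPower] using hp

/-- Any `N` out of `M` independent beams are distributed as `N` independent beams. -/
lemma measurePreserving_beams_comp (Nt : ℕ) {N M : ℕ} {e : Fin N → Fin M}
    (he : Function.Injective e) :
    MeasurePreserving (fun p : (Fin Nt → ℂ) × (Fin M → Fin Nt → ℂ) => (p.1, fun n => p.2 (e n)))
      (jointLaw Nt M) (jointLaw Nt N) := by
  have hbeam : MeasurePreserving (fun (Φ : Fin M → Fin Nt → ℂ) n => Φ (e n))
      (beamLaw Nt M) (beamLaw Nt N) := by
    refine ⟨by fun_prop, ?_⟩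
    have hind : iIndepFun (fun (n : Fin M) (Φ : Fin M → Fin Nt → ℂ) => Φ n) (beamLaw Nt M) :=
      iIndepFun_pi (X := fun _ (φ : Fin Nt → ℂ) => φ) fun _ => aemeasurable_id
    have := (iIndepFun_iff_map_fun_eq_pi_map fun n =>
      (measurable_pi_apply (e n)).aemeasurable).1 (hind.precomp he)
    rw [this, beamLaw]
    congr 1
    ext1 n
    exact (measurePreserving_beam Nt M (e n)).map_eq
  exact (MeasurePreserving.id _).prod hbeam

/-! ### Integrable real random variables: pre-log limit, partial means, tails. -/

variable {Ω : Type*} [MeasurableSpace Ω] {μ : Measure Ω} {X : Ω → ℝ}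

/-- The pre-log factor of the rate `log₂ (1 + c p X)` on an event `s` is the probability of `s`. -/
lemma tendsto_integral_indicator_logb_div [IsProbabilityMeasure μ] (hXm : Measurable X)
    (hX : Integrable X μ) (hX0 : ∀ ω, 0 ≤ X ω) (hpos : ∀ᵐ ω ∂μ, 0 < X ω) {c : ℝ} (hc : 0 < c) {s : Set Ω}
    (hs : MeasurableSet s) :
    Tendsto (fun p : ℝ => (∫ ω, s.indicator (fun ω => Real.logb 2 (1 + c * p * X ω)) ω ∂μ) /
      Real.logb 2 p) atTop (𝓝 (μ.real s)) := by
  have hlim : μ.real s = ∫ ω, s.indicator (fun _ => (1 : ℝ)) ω ∂μ := by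
    rw [integral_indicator hs]; simp [Measure.real]
  simp only [hlim, ← integral_div]
  -- For `p ≥ 2`, `log (1 + c p X) ≤ log p + c X`; dividing by `log p ≥ log 2` gives this bound.
  refine tendsto_integral_filter_of_dominated_convergence (fun ω => 1 + c * X ω / Real.log 2)
    ?_ ?_ ?_ ?_
  · refine Eventually.of_forall fun p => Measurable.aestronglyMeasurable ?_
    refine (Measurable.indicator ?_ hs).div_const _
    unfold Real.logb
    fun_prop
  · filter_upwards [eventually_ge_atTop 2] with p hp
    refine ae_of_all _ fun ω => ?_
    have h2 : 0 < Real.log 2 := Real.log_pos (by norm_num)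
    have hcX : 0 ≤ c * X ω := mul_nonneg hc.le (hX0 ω)
    have hbound : 0 ≤ 1 + c * X ω / Real.log 2 := by positivity
    by_cases hω : ω ∈ s
    · rw [Set.indicator_of_mem hω, Real.logb, Real.logb, div_div_div_cancel_right₀ h2.ne']
      have hlp : Real.log 2 ≤ Real.log p := Real.log_le_log (by norm_num) hp
      have hlp0 : 0 < Real.log p := h2.trans_le hlp
      have hp0 : 0 < p := by linarith
      have h1 : 1 ≤ 1 + c * p * X ω := by
        have : 0 ≤ c * p * X ω := by have := hX0 ω; positivity
        linarith
      rw [Real.norm_of_nonneg (div_nonneg (Real.log_nonneg h1) hlp0.le), div_le_iff₀ hlp0]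
      calc Real.log (1 + c * p * X ω) ≤ Real.log (p * (1 + c * X ω)) :=
            Real.log_le_log (by linarith) (by nlinarith)
        _ = Real.log p + Real.log (1 + c * X ω) := Real.log_mul hp0.ne' (by positivity)
        _ ≤ Real.log p + c * X ω := by
            have := Real.log_le_sub_one_of_pos (x := 1 + c * X ω) (by positivity)
            linarith
        _ ≤ Real.log p + c * X ω / Real.log 2 * Real.log p := by
            have : c * X ω / Real.log 2 * Real.log 2 ≤ c * X ω / Real.log 2 * Real.log p := by
              gcongr
            rw [div_mul_cancel₀ _ h2.ne'] at this
            linarith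
        _ = (1 + c * X ω / Real.log 2) * Real.log p := by ring
    · simpa [Set.indicator_of_notMem hω] using hbound
  · exact (integrable_const _).add ((hX.const_mul c).div_const _)
  · filter_upwards [hpos] with ω hω
    by_cases hs' : ω ∈ s
    · simp only [Set.indicator_of_mem hs']
      have hcX : 0 < c * X ω := mul_pos hc hω
      have h2 : Real.log 2 ≠ 0 := (Real.log_pos (by norm_num)).ne'
      -- Factoring out `p` gives `log (1 + c p X) = log p + log (p⁻¹ + c X)`; the last term stays
      -- bounded because `X > 0`.
      have hlog : Tendsto (fun p : ℝ => 1 + Real.log (p⁻¹ + c * X ω) / Real.log p) atTop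
          (𝓝 (1 + 0)) := by
        refine Tendsto.add tendsto_const_nhds (Tendsto.div_atTop (a := Real.log (0 + c * X ω)) ?_
          Real.tendsto_log_atTop)
        exact ((tendsto_inv_atTop_zero.add_const _).log (by simpa using hcX.ne'))
      rw [add_zero] at hlog
      refine hlog.congr' ?_
      filter_upwards [eventually_gt_atTop 1] with p hp
      have hp0 : 0 < p := by linarith
      have hlp : Real.log p ≠ 0 := (Real.log_pos hp).ne'
      rw [Real.logb, Real.logb, div_div_div_cancel_right₀ h2,
        show 1 + c * p * X ω = p * (p⁻¹ + c * X ω) by field_simp,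
        Real.log_mul hp0.ne' (by positivity), add_div, div_self hlp]
    · simp [Set.indicator_of_notMem hs']

/-- A random variable of mean one has a partial mean below `a` less than the probability of being
below `a`, unless one of the two tail contributions vanishes. -/
lemma setIntegral_le_lt_measure [IsProbabilityMeasure μ] (hXm : Measurable X)
    (hX : Integrable X μ) (hmean : ∫ ω, X ω ∂μ = 1) {a : ℝ} (hlow : 0 < ∫ ω in {ω | X ω ≤ a}, X ω ∂μ)
    (hup : 0 < ∫ ω in {ω | a < X ω}, X ω ∂μ) :
    ∫ ω in {ω | X ω ≤ a}, X ω ∂μ < μ.real {ω | X ω ≤ a} := by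
  have hm : MeasurableSet {ω | X ω ≤ a} := measurableSet_le hXm measurable_const
  have hm' : MeasurableSet {ω | a < X ω} := measurableSet_lt measurable_const hXm
  have hcompl : {ω | X ω ≤ a}ᶜ = {ω | a < X ω} := by ext; simp
  have hsplit := integral_add_compl hm hX
  have hmsplit := probReal_compl_eq_one_sub (μ := μ) hm
  rw [hcompl] at hsplit hmsplit
  have hle : ∫ ω in {ω | X ω ≤ a}, X ω ∂μ ≤ a * μ.real {ω | X ω ≤ a} := by
    have := setIntegral_mono_on hX.integrableOn (integrable_const a).integrableOn hm
      fun ω hω => hω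
    simpa [mul_comm] using this
  have hpos : 0 < μ.real {ω | X ω ≤ a} := by
    refine lt_of_le_of_ne measureReal_nonneg fun h => ?_
    rw [← h] at hle
    linarith
  have hpos' : 0 < μ {ω | a < X ω} := by
    refine pos_iff_ne_zero.2 fun h => ?_
    rw [Measure.restrict_eq_zero.2 h] at hup
    simp at hup
  have hlt : a * μ.real {ω | a < X ω} < ∫ ω in {ω | a < X ω}, X ω ∂μ := by
    have hint : IntegrableOn (fun ω => X ω - a) {ω | a < X ω} μ :=
      (hX.sub (integrable_const a)).integrableOn
    have : 0 < ∫ ω in {ω | a < X ω}, (X ω - a) ∂μ := by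
      rw [setIntegral_pos_iff_support_of_nonneg_ae _ hint]
      · refine hpos'.trans_le (measure_mono fun ω hω => ⟨?_, hω⟩)
        have : a < X ω := hω
        exact sub_ne_zero.2 this.ne'
      · filter_upwards [ae_restrict_mem hm'] with ω hω
        have : a < X ω := hω
        simpa using this.le
    rw [integral_sub hX.integrableOn (integrable_const a).integrableOn] at this
    simp only [integral_const, measureReal_restrict_apply_univ, smul_eq_mul] at this
    linarith
  -- With `m = P(X ≤ a)` and `L` the partial mean, `L ≤ a m` and `1 - L > a (1 - m)`. If `L ≥ m`,
  -- the first forces `a ≥ 1`, and the second then gives `L < m`.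
  nlinarith

lemma integral_posPart_sub_eq [IsProbabilityMeasure μ] (hXm : Measurable X)
    (hX : Integrable X μ) (a : ℝ) :
    ∫ ω, max (a - X ω) 0 ∂μ = a * μ.real {ω | X ω ≤ a} - ∫ ω in {ω | X ω ≤ a}, X ω ∂μ := by
  have hm : MeasurableSet {ω | X ω ≤ a} := measurableSet_le hXm measurable_const
  have : (fun ω => max (a - X ω) 0) = {ω | X ω ≤ a}.indicator fun ω => a - X ω := by
    ext ω
    by_cases h : X ω ≤ a
    · rw [Set.indicator_of_mem (by exact h), max_eq_left (by linarith)]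
    · rw [Set.indicator_of_notMem (by exact h), max_eq_right (by linarith)]
  rw [this, integral_indicator hm, integral_sub (integrable_const a).integrableOn hX.integrableOn]
  simp [mul_comm]

/-- Among all events, `{X ≤ a}` maximizes the integral of `a - X`, so a mismatched threshold `b` can
only lose. This removes any need to compare the two thresholds. -/
lemma le_integral_posPart_sub [IsProbabilityMeasure μ] (hXm : Measurable X)
    (hX : Integrable X μ) (a b : ℝ) :
    a * μ.real {ω | X ω ≤ b} - ∫ ω in {ω | X ω ≤ b}, X ω ∂μ ≤ ∫ ω, max (a - X ω) 0 ∂μ := by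
  have hm : MeasurableSet {ω | X ω ≤ b} := measurableSet_le hXm measurable_const
  have hint : Integrable (fun ω => max (a - X ω) 0) μ := ((integrable_const a).sub hX).pos_part
  have h1 : ∫ ω in {ω | X ω ≤ b}, (a - X ω) ∂μ ≤ ∫ ω in {ω | X ω ≤ b}, max (a - X ω) 0 ∂μ :=
    integral_mono ((integrable_const a).sub hX).integrableOn hint.integrableOn
      fun ω => le_max_left _ _
  have h2 := setIntegral_le_integral (s := {ω | X ω ≤ b}) hint
    (ae_of_all _ fun ω => le_max_right _ _)
  rw [integral_sub (integrable_const a).integrableOn hX.integrableOn] at h1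
  simp only [integral_const, measureReal_restrict_apply_univ, smul_eq_mul] at h1
  linarith

/-- Without an atom at `a`, the truncated integrand is almost surely locally constant in the
threshold near `a`; dominated convergence applies. -/
lemma continuous_setIntegral_gt (hXm : Measurable X) (hX : Integrable X μ)
    (hatom : ∀ a, ∀ᵐ ω ∂μ, X ω ≠ a) :
    Continuous fun a => ∫ ω in {ω | a < X ω}, X ω ∂μ := by
  have hm (a : ℝ) : MeasurableSet {ω | a < X ω} := measurableSet_lt measurable_const hXm
  simp only [← integral_indicator (hm _)]
  refine continuous_iff_continuousAt.2 fun a => continuousAt_of_dominated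
    (bound := fun ω => ‖X ω‖) (Eventually.of_forall fun b =>
      (hXm.indicator (hm b)).aestronglyMeasurable)
    (Eventually.of_forall fun b => ae_of_all _ fun ω => norm_indicator_le_norm_self _ _)
    hX.norm ?_
  filter_upwards [hatom a] with ω hω
  rcases lt_or_gt_of_ne hω with h | h
  · refine continuousAt_const.congr (f := fun _ => (0 : ℝ)) ?_
    filter_upwards [lt_mem_nhds h] with b hb
    exact (Set.indicator_of_notMem (by simpa using hb.le) _).symm
  · refine continuousAt_const.congr (f := fun _ => X ω) ?_
    filter_upwards [gt_mem_nhds h] with b hb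
    exact (Set.indicator_of_mem (by exact hb) _).symm

lemma tendsto_setIntegral_gt_atTop (hXm : Measurable X) (hX : Integrable X μ) :
    Tendsto (fun a => ∫ ω in {ω | a < X ω}, X ω ∂μ) atTop (𝓝 0) := by
  have hm (a : ℝ) : MeasurableSet {ω | a < X ω} := measurableSet_lt measurable_const hXm
  simp only [← integral_indicator (hm _)]
  rw [← integral_zero Ω ℝ (μ := μ)]
  refine tendsto_integral_filter_of_dominated_convergence (fun ω => ‖X ω‖)
    (Eventually.of_forall fun b => (hXm.indicator (hm b)).aestronglyMeasurable)
    (Eventually.of_forall fun b => ae_of_all _ fun ω => norm_indicator_le_norm_self _ _)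
    hX.norm (ae_of_all _ fun ω => ?_)
  refine tendsto_const_nhds.congr' ?_
  filter_upwards [eventually_ge_atTop (X ω)] with a ha
  exact (Set.indicator_of_notMem (by simpa using ha) _).symm

/-! ### Rate and power factors as probabilities and partial means. -/

lemma measurable_jointPower (Nt N : ℕ) : Measurable (jointPower Nt N) :=
  (continuous_jointPower Nt N).measurable

lemma avgRateTS_eq {Nt N : ℕ} (hNt : Nt ≠ 0) {θ σ p : ℝ} (hθ : 0 < θ) (hp : 0 < p)
    (Abar : ℝ) :
    avgRateTS θ σ p Nt N Abar = ∫ ω, {ω | jointPower Nt N ω ≤ Abar}.indicator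
      (fun ω => Real.logb 2 (1 + θ / σ ^ 2 * p * jointPower Nt N ω)) ω ∂(jointLaw Nt N) := by
  have hm : MeasurableSet {ω | jointPower Nt N ω ≤ Abar} :=
    measurableSet_le (measurable_jointPower Nt N) measurable_const
  have hXm := measurable_jointPower Nt N
  have hc : 0 ≤ θ / σ ^ 2 * p := by positivity
  have h2 : 0 < Real.log 2 := Real.log_pos (by norm_num)
  have hint : Integrable ({ω | jointPower Nt N ω ≤ Abar}.indicator
      (fun ω => Real.logb 2 (1 + θ / σ ^ 2 * p * jointPower Nt N ω))) (jointLaw Nt N) := by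
    refine Integrable.indicator ?_ hm
    refine (((integrable_jointPower hNt N).const_mul (θ / σ ^ 2 * p)).div_const
      (Real.log 2)).mono' ?_ (ae_of_all _ fun ω => ?_)
    · refine Measurable.aestronglyMeasurable ?_
      unfold Real.logb
      fun_prop
    · have hX := mul_nonneg hc (jointPower_nonneg ω)
      rw [Real.logb, norm_div, Real.norm_of_nonneg (Real.log_nonneg (by linarith)),
        Real.norm_of_nonneg h2.le]
      gcongr
      linarith [Real.log_le_sub_one_of_pos
        (show 0 < 1 + θ / σ ^ 2 * p * jointPower Nt N ω by linarith)]
  rw [jointLaw, integral_prod _ hint]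
  unfold avgRateTS rateTS
  congr! 4 with h Φ
  by_cases hA : subblockPower h Φ ≤ Abar
  · rw [Set.indicator_of_mem (by exact hA), switching, if_pos hA, one_mul, jointPower]
    congr 2
    ring
  · rw [Set.indicator_of_notMem (by exact hA), switching, if_neg hA, zero_mul]

lemma powerFactorTS_eq {Nt : ℕ} (hNt : Nt ≠ 0) {θ P : ℝ} (hθ : 0 < θ) (hP : 0 < P) (N : ℕ)
    (Abar : ℝ) :
    powerFactorTS θ P Nt N Abar =
      ∫ ω in {ω | Abar < jointPower Nt N ω}, jointPower Nt N ω ∂(jointLaw Nt N) := by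
  have hm : MeasurableSet {ω | Abar < jointPower Nt N ω} :=
    measurableSet_lt measurable_const (measurable_jointPower Nt N)
  have hθP : θ * P ≠ 0 := by positivity
  rw [powerFactorTS, div_eq_iff hθP, ← integral_indicator hm, ← integral_mul_const, jointLaw,
    integral_prod _ (((integrable_jointPower hNt N).indicator hm).mul_const _)]
  unfold avgPowerTS powerTS
  congr! 4 with h Φ
  by_cases hA : subblockPower h Φ ≤ Abar
  · rw [Set.indicator_of_notMem (by simpa [jointPower] using hA), switching, if_pos hA]
    ring
  · rw [Set.indicator_of_mem (by simpa [jointPower] using hA), switching, if_neg hA, jointPower]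
    ring

lemma tendsto_rateTS {Nt N : ℕ} (hNt : Nt ≠ 0) (hN : N ≠ 0) {θ σ : ℝ} (hθ : 0 < θ) (hσ : 0 < σ)
    (Abar : ℝ) :
    Tendsto (fun p : ℝ => avgRateTS θ σ p Nt N Abar / Real.logb 2 p) atTop
      (𝓝 ((jointLaw Nt N).real {ω | jointPower Nt N ω ≤ Abar})) := by
  refine (tendsto_integral_indicator_logb_div (measurable_jointPower Nt N)
    (integrable_jointPower hNt N) jointPower_nonneg (ae_jointPower_pos hNt hN)
    (show 0 < θ / σ ^ 2 by positivity)
    (measurableSet_le (measurable_jointPower Nt N) measurable_const)).congr' ?_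
  filter_upwards [eventually_gt_atTop 0] with p hp
  rw [avgRateTS_eq hNt hθ hp]

lemma rateFactorTS_eq {Nt N : ℕ} (hNt : Nt ≠ 0) (hN : N ≠ 0) {θ σ : ℝ} (hθ : 0 < θ)
    (hσ : 0 < σ) (Abar : ℝ) :
    rateFactorTS θ σ Nt N Abar = (jointLaw Nt N).real {ω | jointPower Nt N ω ≤ Abar} :=
  (tendsto_rateTS hNt hN hθ hσ Abar).limUnder_eq

lemma tendsto_ratePS {Nt : ℕ} (hNt : Nt ≠ 0) {θ σ : ℝ} (hθ : 0 < θ) (hσ : 0 < σ) (τ : ℝ) :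
    Tendsto (fun p : ℝ => avgRatePS θ σ p Nt τ / Real.logb 2 p) atTop (𝓝 τ) := by
  have := (tendsto_integral_indicator_logb_div (continuous_channelPower Nt).measurable
    (integrable_channelPower Nt).1 channelPower_nonneg (ae_channelPower_pos hNt)
    (show 0 < θ / σ ^ 2 by positivity) MeasurableSet.univ).const_mul τ
  rw [probReal_univ, mul_one] at this
  refine this.congr fun p => ?_
  unfold avgRatePS ratePS
  rw [integral_const_mul, mul_div_assoc]
  simp only [Set.indicator_univ]
  congr! 6
  ring

lemma rateFactorPS_eq {Nt : ℕ} (hNt : Nt ≠ 0) {θ σ : ℝ} (hθ : 0 < θ) (hσ : 0 < σ) (τ : ℝ) :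
    rateFactorPS θ σ Nt τ = τ :=
  (tendsto_ratePS hNt hθ hσ τ).limUnder_eq

lemma powerFactorPS_eq {Nt : ℕ} (hNt : Nt ≠ 0) {θ P : ℝ} (hθ : 0 < θ) (hP : 0 < P) (τ : ℝ) :
    powerFactorPS θ P Nt τ = 1 - τ := by
  unfold powerFactorPS avgPowerPS powerPS
  rw [integral_const_mul, integral_const_mul, (integrable_channelPower Nt).2 hNt]
  field_simp

lemma setIntegral_jointPower_le {Nt N : ℕ} (hNt : Nt ≠ 0) (hN : N ≠ 0) (a : ℝ) :
    ∫ ω in {ω | jointPower Nt N ω ≤ a}, jointPower Nt N ω ∂(jointLaw Nt N) =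
      1 - ∫ ω in {ω | a < jointPower Nt N ω}, jointPower Nt N ω ∂(jointLaw Nt N) := by
  have hsplit := integral_add_compl
    (measurableSet_le (measurable_jointPower Nt N) (measurable_const (a := a)))
    (integrable_jointPower hNt N)
  have hcompl : {ω | jointPower Nt N ω ≤ a}ᶜ = {ω | a < jointPower Nt N ω} := by ext; simp
  rw [hcompl, integral_jointPower hNt hN] at hsplit
  linarith

/-! ### Comparing numbers of beams, and the one-beam threshold. -/

/-- The power of `M` beams is the average of the powers of its cyclic blocks of `N` beams. -/
lemma subblockPower_eq_average {Nt N M : ℕ} [NeZero M] (hN : N ≠ 0) (hNM : N ≤ M)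
    (h : Fin Nt → ℂ) (Φ : Fin M → Fin Nt → ℂ) :
    subblockPower h Φ =
      (1 / (M : ℝ)) * ∑ k : Fin M, subblockPower h fun n : Fin N => Φ (Fin.castLE hNM n + k) := by
  unfold subblockPower
  rw [← Finset.mul_sum, Finset.sum_comm]
  -- For fixed `n`, adding `k` modulo `M` runs through every beam once, so each beam is counted `N`
  -- times in all.
  have (n : Fin N) : ∑ k : Fin M,
      ‖equivalentChannel h (fun n : Fin N => Φ (Fin.castLE hNM n + k)) n‖ ^ 2 =
        ∑ m, ‖equivalentChannel h Φ m‖ ^ 2 :=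
    Equiv.sum_comp (Equiv.addLeft (Fin.castLE hNM n)) fun m => ‖equivalentChannel h Φ m‖ ^ 2
  simp only [this, Finset.sum_const, Finset.card_univ, Fintype.card_fin, nsmul_eq_mul]
  field_simp

/-- Jensen for the convex function `x ↦ (a - x)⁺`, applied to the average over cyclic blocks. It is
strict where two blocks lie on opposite sides of the kink `a`, an event of positive probability. -/
lemma integral_posPart_jointPower_lt {Nt N M : ℕ} (hNt : Nt ≠ 0) (hN : N ≠ 0) (hNM : N < M)
    {a : ℝ} (ha : 0 < a) :
    ∫ ω, max (a - jointPower Nt M ω) 0 ∂(jointLaw Nt M) <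
      ∫ ω, max (a - jointPower Nt N ω) 0 ∂(jointLaw Nt N) := by
  have hM : 1 < M := by omega
  have : NeZero M := ⟨by omega⟩
  have hM0 : (0 : ℝ) < M := by positivity
  let T (k : Fin M) (ω : (Fin Nt → ℂ) × (Fin M → Fin Nt → ℂ)) :
    (Fin Nt → ℂ) × (Fin N → Fin Nt → ℂ) := (ω.1, fun n => ω.2 (Fin.castLE hNM.le n + k))
  have hT (k : Fin M) : MeasurePreserving (T k) (jointLaw Nt M) (jointLaw Nt N) :=
    measurePreserving_beams_comp Nt
      ((add_left_injective k).comp (Fin.castLE_injective hNM.le))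
  have hTc (k : Fin M) : Continuous (T k) := by fun_prop
  have hTi (k : Fin M) : Continuous fun ω => jointPower Nt N (T k ω) :=
    (continuous_jointPower Nt N).comp (hTc k)
  have hint (K : ℕ) : Integrable (fun ω => max (a - jointPower Nt K ω) 0) (jointLaw Nt K) :=
    ((integrable_const a).sub (integrable_jointPower hNt K)).pos_part
  have hintT (k : Fin M) :
      Integrable (fun ω => max (a - jointPower Nt N (T k ω)) 0) (jointLaw Nt M) :=
    (hT k).integrable_comp_of_integrable (hint N)
  have havg : ∫ ω, max (a - jointPower Nt N ω) 0 ∂(jointLaw Nt N) =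
      ∫ ω, (1 / (M : ℝ)) * ∑ k, max (a - jointPower Nt N (T k ω)) 0 ∂(jointLaw Nt M) := by
    have hk (k : Fin M) : ∫ ω, max (a - jointPower Nt N (T k ω)) 0 ∂(jointLaw Nt M) =
        ∫ ω, max (a - jointPower Nt N ω) 0 ∂(jointLaw Nt N) := by
      rw [← (hT k).map_eq, integral_map (hT k).measurable.aemeasurable]
      rw [(hT k).map_eq]
      exact (hint N).1
    rw [integral_const_mul, integral_finsetSum _ fun k _ => hintT k]
    simp only [hk, Finset.sum_const, Finset.card_univ, Fintype.card_fin, nsmul_eq_mul]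
    field_simp
  have hsplit (ω) : a - jointPower Nt M ω =
      (1 / (M : ℝ)) * ∑ k, (a - jointPower Nt N (T k ω)) := by
    have : jointPower Nt M ω = (1 / (M : ℝ)) * ∑ k, jointPower Nt N (T k ω) :=
      subblockPower_eq_average hN hNM.le ω.1 ω.2
    rw [this, Finset.sum_sub_distrib, mul_sub]
    simp [hM0.ne']
  have hle (ω) : max (a - jointPower Nt M ω) 0 ≤
      (1 / (M : ℝ)) * ∑ k, max (a - jointPower Nt N (T k ω)) 0 := by
    rw [hsplit]
    refine max_le ?_ (by positivity)
    gcongr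
    exact le_max_left _ _
  have hlt (ω) (h0 : a < jointPower Nt N (T 0 ω)) (h1 : jointPower Nt N (T 1 ω) < a) :
      max (a - jointPower Nt M ω) 0 <
        (1 / (M : ℝ)) * ∑ k, max (a - jointPower Nt N (T k ω)) 0 := by
    rw [hsplit]
    refine max_lt ?_ ?_
    · refine mul_lt_mul_of_pos_left ?_ (by positivity)
      refine Finset.sum_lt_sum (fun k _ => le_max_left _ _) ⟨0, Finset.mem_univ _, ?_⟩
      exact lt_max_of_lt_right (by linarith)
    · refine mul_pos (by positivity) (Finset.sum_pos' (fun k _ => le_max_right _ _)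
        ⟨1, Finset.mem_univ _, lt_max_of_lt_left (by linarith)⟩)
  rw [havg, ← sub_pos]
  have hintA : Integrable (fun ω => (1 / (M : ℝ)) * ∑ k, max (a - jointPower Nt N (T k ω)) 0)
      (jointLaw Nt M) := (integrable_finsetSum _ fun k _ => hintT k).const_mul _
  rw [← integral_sub hintA (hint M), integral_pos_iff_support_of_nonneg
    (fun ω => sub_nonneg.2 (hle ω)) (hintA.sub (hint M))]
  have := isOpenPosMeasure_jointLaw hNt M
  have hopen : IsOpen {ω | a < jointPower Nt N (T 0 ω) ∧ jointPower Nt N (T 1 ω) < a} :=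
    (isOpen_lt continuous_const (hTi 0)).inter (isOpen_lt (hTi 1) continuous_const)
  refine (hopen.measure_pos _ ?_).trans_le
    (measure_mono fun ω hω => (sub_pos.2 (hlt ω hω.1 hω.2)).ne')
  let i₀ : Fin Nt := ⟨0, Nat.pos_of_ne_zero hNt⟩
  let r : ℝ := √(N * (a + 1))
  -- Only beam `0` is switched on. Block `0` contains it, and `r` gives that block power at least `a
  -- + 1`; block `1` consists of beams `1, …, N` and has power zero.
  refine ⟨(Pi.single i₀ 1, fun m => if m = 0 then Pi.single i₀ (r : ℂ) else 0), ?_, ?_⟩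
  · have hr : r ^ 2 = N * (a + 1) := Real.sq_sqrt (by positivity)
    have hN0 : (0 : ℝ) < N := by exact_mod_cast Nat.pos_of_ne_zero hN
    have hsum : r ^ 2 ≤ ∑ n : Fin N, ‖equivalentChannel (Pi.single i₀ 1) (fun n : Fin N =>
        if Fin.castLE hNM.le n + 0 = 0 then Pi.single i₀ (r : ℂ) else 0) n‖ ^ 2 := by
      refine le_trans (le_of_eq ?_) (Finset.single_le_sum (fun _ _ => sq_nonneg _)
        (Finset.mem_univ (⟨0, Nat.pos_of_ne_zero hN⟩ : Fin N)))
      have : Fin.castLE hNM.le (⟨0, Nat.pos_of_ne_zero hN⟩ : Fin N) = 0 := by ext; simp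
      simp [equivalentChannel, this, Pi.single_apply]
    change a < (1 / (N : ℝ)) * _
    rw [one_div, ← div_eq_inv_mul, lt_div_iff₀ hN0]
    refine lt_of_lt_of_le ?_ hsum
    rw [hr]
    nlinarith
  -- Since `n + 1 ≤ N < M`, block `1` does not wrap around to beam `0`.
  · have hne (n : Fin N) : Fin.castLE hNM.le n + 1 ≠ 0 := by
      intro h
      have := congrArg Fin.val h
      rw [Fin.val_add, Fin.coe_ofNat_eq_mod, Nat.mod_eq_of_lt hM, Fin.val_castLE,
        Nat.mod_eq_of_lt (by omega)] at this
      simp at this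
    simpa [T, jointPower, subblockPower, equivalentChannel, hne] using ha

lemma rateFactor_lt_of_lt {Nt N M : ℕ} (hNt : Nt ≠ 0) (hN : N ≠ 0) (hNM : N < M) {a b : ℝ}
    (ha : 0 < a)
    (heq : ∫ ω in {ω | a < jointPower Nt N ω}, jointPower Nt N ω ∂(jointLaw Nt N) =
      ∫ ω in {ω | b < jointPower Nt M ω}, jointPower Nt M ω ∂(jointLaw Nt M)) :
    (jointLaw Nt M).real {ω | jointPower Nt M ω ≤ b} <
      (jointLaw Nt N).real {ω | jointPower Nt N ω ≤ a} := by
  have h1 := integral_posPart_jointPower_lt hNt hN hNM ha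
  have h2 := integral_posPart_sub_eq (measurable_jointPower Nt N) (integrable_jointPower hNt N) a
  have h3 := le_integral_posPart_sub (measurable_jointPower Nt M)
    (integrable_jointPower hNt M) a b
  rw [setIntegral_jointPower_le hNt hN] at h2
  rw [setIntegral_jointPower_le hNt (by omega : M ≠ 0)] at h3
  refine lt_of_mul_lt_mul_left (a := a) ?_ ha.le
  linarith

lemma exists_threshold_one_beam {Nt : ℕ} (hNt : Nt ≠ 0) {q : ℝ} (hq0 : 0 < q) (hq1 : q < 1) :
    ∃ a : ℝ, 0 < a ∧
      ∫ ω in {ω | a < jointPower Nt 1 ω}, jointPower Nt 1 ω ∂(jointLaw Nt 1) = q := by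
  have hm := measurable_jointPower Nt 1
  have hint := integrable_jointPower hNt 1
  have hcont := continuous_setIntegral_gt hm hint (ae_jointPower_one_ne hNt)
  have hzero : ∫ ω in {ω | 0 < jointPower Nt 1 ω}, jointPower Nt 1 ω ∂(jointLaw Nt 1) = 1 := by
    rw [← integral_jointPower hNt one_ne_zero, ← integral_indicator
      (measurableSet_lt measurable_const hm)]
    refine integral_congr_ae ?_
    filter_upwards [ae_jointPower_pos hNt one_ne_zero] with ω hω
    exact Set.indicator_of_mem (by exact hω) _
  obtain ⟨b, hb0, hb⟩ := ((eventually_ge_atTop (0 : ℝ)).and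
    ((tendsto_setIntegral_gt_atTop hm hint).eventually_lt_const hq0)).exists
  obtain ⟨a, ha, haq⟩ := intermediate_value_Icc' hb0 hcont.continuousOn
    ⟨hb.le, hq1.le.trans_eq hzero.symm⟩
  -- At threshold zero the tail carries the whole mean `1 > q`, so `a` cannot be zero.
  refine ⟨a, lt_of_le_of_ne ha.1 ?_, haq⟩
  rintro rfl
  exact hq1.ne (haq.symm.trans hzero)

end SWIPT

theorem theorem3p1 (Nt : ℕ) (hNt : 1 < Nt) (θ σ P : ℝ) (hθ : 0 < θ) (hσ : 0 < σ) (hP : 0 < P) :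
    -- the limits defining the rate pre-log factors exist
    (∀ (N : ℕ) (Abar : ℝ), 1 ≤ N → N ≤ Nt → 0 < Abar →
      Tendsto (fun p : ℝ => SWIPT.avgRateTS θ σ p Nt N Abar / Real.logb 2 p) atTop
        (𝓝 (SWIPT.rateFactorTS θ σ Nt N Abar))) ∧
    (∀ τ : ℝ, 0 < τ → τ < 1 →
      Tendsto (fun p : ℝ => SWIPT.avgRatePS θ σ p Nt τ / Real.logb 2 p) atTop
        (𝓝 (SWIPT.rateFactorPS θ σ Nt τ))) ∧
    -- threshold switching beats periodic switching
    (∀ (N : ℕ) (Abar τ : ℝ), 1 ≤ N → N ≤ Nt → 0 < Abar → 0 < τ → τ < 1 →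
      SWIPT.powerFactorTS θ P Nt N Abar = SWIPT.powerFactorPS θ P Nt τ →
      0 < SWIPT.powerFactorTS θ P Nt N Abar → SWIPT.powerFactorTS θ P Nt N Abar < 1 →
      SWIPT.rateFactorPS θ σ Nt τ < SWIPT.rateFactorTS θ σ Nt N Abar) ∧
    -- fewer beams beat more beams
    (∀ (N M : ℕ) (AN AM : ℝ), 1 ≤ N → N < M → M ≤ Nt → 0 < AN → 0 < AM →
      SWIPT.powerFactorTS θ P Nt N AN = SWIPT.powerFactorTS θ P Nt M AM →
      0 < SWIPT.powerFactorTS θ P Nt N AN → SWIPT.powerFactorTS θ P Nt N AN < 1 →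
      SWIPT.rateFactorTS θ σ Nt M AM < SWIPT.rateFactorTS θ σ Nt N AN) ∧
    -- a single random beam is optimal at every power scaling factor in (0, 1)
    (∀ q : ℝ, 0 < q → q < 1 →
      ∃ A₁ : ℝ, 0 < A₁ ∧ SWIPT.powerFactorTS θ P Nt 1 A₁ = q ∧
        (∀ (M : ℕ) (AM : ℝ), 1 < M → M ≤ Nt → 0 < AM → SWIPT.powerFactorTS θ P Nt M AM = q →
          SWIPT.rateFactorTS θ σ Nt M AM < SWIPT.rateFactorTS θ σ Nt 1 A₁) ∧
        (∀ τ : ℝ, 0 < τ → τ < 1 → SWIPT.powerFactorPS θ P Nt τ = q →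
          SWIPT.rateFactorPS θ σ Nt τ < SWIPT.rateFactorTS θ σ Nt 1 A₁)) := by
  have hNt0 : Nt ≠ 0 := by omega
  have periodic (N : ℕ) (Abar τ : ℝ) (hN : 1 ≤ N)
      (heq : SWIPT.powerFactorTS θ P Nt N Abar = SWIPT.powerFactorPS θ P Nt τ)
      (h0 : 0 < SWIPT.powerFactorTS θ P Nt N Abar) (h1 : SWIPT.powerFactorTS θ P Nt N Abar < 1) :
      SWIPT.rateFactorPS θ σ Nt τ < SWIPT.rateFactorTS θ σ Nt N Abar := by
    have hN0 : N ≠ 0 := by omega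
    rw [SWIPT.powerFactorTS_eq hNt0 hθ hP] at heq h0 h1
    rw [SWIPT.powerFactorPS_eq hNt0 hθ hP] at heq
    rw [SWIPT.rateFactorPS_eq hNt0 hθ hσ, SWIPT.rateFactorTS_eq hNt0 hN0 hθ hσ]
    -- Equal power factors make the partial mean below the threshold equal to `τ`.
    have hle := SWIPT.setIntegral_jointPower_le hNt0 hN0 Abar
    have := SWIPT.setIntegral_le_lt_measure (SWIPT.measurable_jointPower Nt N)
      (SWIPT.integrable_jointPower hNt0 N) (SWIPT.integral_jointPower hNt0 hN0)
      (by linarith) h0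
    linarith
  have beams (N M : ℕ) (AN AM : ℝ) (hN : 1 ≤ N) (hNM : N < M) (hAN : 0 < AN)
      (heq : SWIPT.powerFactorTS θ P Nt N AN = SWIPT.powerFactorTS θ P Nt M AM) :
      SWIPT.rateFactorTS θ σ Nt M AM < SWIPT.rateFactorTS θ σ Nt N AN := by
    rw [SWIPT.powerFactorTS_eq hNt0 hθ hP, SWIPT.powerFactorTS_eq hNt0 hθ hP] at heq
    rw [SWIPT.rateFactorTS_eq hNt0 (by omega) hθ hσ, SWIPT.rateFactorTS_eq hNt0 (by omega) hθ hσ]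
    exact SWIPT.rateFactor_lt_of_lt hNt0 (by omega) hNM hAN heq
  refine ⟨fun N Abar hN _ _ => ?_, fun τ _ _ => ?_,
    fun N Abar τ hN _ _ _ _ heq h0 h1 => periodic N Abar τ hN heq h0 h1,
    fun N M AN AM hN hNM _ hAN _ heq _ _ => beams N M AN AM hN hNM hAN heq, fun q hq0 hq1 => ?_⟩
  · rw [SWIPT.rateFactorTS_eq hNt0 (by omega) hθ hσ]
    exact SWIPT.tendsto_rateTS hNt0 (by omega) hθ hσ Abar
  · rw [SWIPT.rateFactorPS_eq hNt0 hθ hσ]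
    exact SWIPT.tendsto_ratePS hNt0 hθ hσ τ
  · obtain ⟨a, ha, haq⟩ := SWIPT.exists_threshold_one_beam hNt0 hq0 hq1
    rw [← SWIPT.powerFactorTS_eq hNt0 hθ hP] at haq
    exact ⟨a, ha, haq, fun M AM hM _ _ hq => beams 1 M a AM le_rfl hM ha (haq.trans hq.symm),
      fun τ _ _ hq => periodic 1 a τ le_rfl (haq.trans hq.symm) (haq ▸ hq0) (haq ▸ hq1)⟩
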